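/- Let $(V,\|\cdot\|)$ be a Minkowski $3$-space, that is, a real normed vector space of dimension $3$, with closed unit ball $C=\{x\in V:\|x\|\le 1\}$. Suppose that there is no (affine) $2$-plane $P\subset V$, through the origin or not, for which the section $C\cap P$ is an ellipse (a filled, non-degenerate one: a set of the form $\{c+su+tv : s,t\in\mathbb{R},\ s^2+t^2\le 1\}$ with $c,u,v\in V$ and $u,v$ linearly independent). Then the group $\mathcal{I}(3)$ of all isometries of $V$ onto itself (bijections preserving the distance $\|x-y\|$) is isomorphic to the semidirect product of the translation group $\mathcal{T}(3)\cong(V,+)$ with a finite group $G$ of invertible linear maps of $V$ of determinant $\pm1$. More precisely, $G$ acts on $\mathcal{T}(3)$ in the natural way, $A\cdot v=A(v)$, and the isomorphism $\mathcal{T}(3)\rtimes G\to\mathcal{I}(3)$ sends $(v,A)$ to the map $x\mapsto A(x)+v$. In particular, the stabilizer of the origin in $\mathcal{I}(3)$ is finite. -/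

import Mathlib

/-- A set is an *ellipse* (understood as a two-dimensional region, as befits a planar section of a
convex body) if it consists of the points `c + s u + t v` with `s ^ 2 + t ^ 2 ≤ 1`, for some centre
`c` and two linearly independent conjugate semi-diameters `u`, `v`. -/
def IsEllipse {V : Type*} [AddCommGroup V] [Module ℝ V] (S : Set V) : Prop :=
  ∃ c u v : V, LinearIndependent ℝ ![u, v] ∧
    S = {x | ∃ s t : ℝ, s ^ 2 + t ^ 2 ≤ 1 ∧ x = c + s • u + t • v}

/-- The natural action of a group of linear automorphisms of `V` on the translation group of `V`,
which is the additive group of `V` written multiplicatively. -/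
def translationAction {V : Type*} [AddCommGroup V] [Module ℝ V] (G : Subgroup (V ≃ₗ[ℝ] V)) :
    G →* MulAut (Multiplicative V) where
  toFun A := AddEquiv.toMultiplicative (A : V ≃ₗ[ℝ] V).toAddEquiv
  map_one' := rfl
  map_mul' _ _ := rfl

/-- The stabilizer of the origin in the group of all isometries of `V`. -/
def originStabilizer (V : Type*) [NormedAddCommGroup V] : Subgroup (V ≃ᵢ V) where
  carrier := {f | f 0 = 0}
  one_mem' := rfl
  mul_mem' {f g} hf hg := by
    change f (g 0) = 0
    rw [show g 0 = 0 from hg]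
    exact hf
  inv_mem' {f} hf := by
    change f.symm 0 = 0
    exact f.symm_apply_eq.mpr (Eq.symm hf)

/-!
The isometries of `V` are the maps `x ↦ A x + v` with `A` a linear isometry (Mazur–Ulam), so
everything rests on the finiteness of the group of linear isometries, which holds because an
infinite one forces the unit ball to have an elliptical section through the origin.

Suppose that there are infinitely many linear isometries. They form a bounded subset of the
finite-dimensional space `V →L[ℝ] V`, so some of them, different from the identity, are arbitrarily
close to it, and normalizing the differences gives a nonzero `X` tangent to the group at the
identity (`exists_isInfinitesimalIsometry`). A linear isometry preserves Haar measure and the unit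
ball, hence also the positive definite form `⟪f, g⟫ = ∫ x in closedBall 0 1, f x * g x` on the dual
space (`momentCore`). Therefore the transpose of `X` is skew for this form, and a nonzero skew
operator `T` in dimension three satisfies `T ^ 3 = -ω ^ 2 • T` for some `ω > 0`
(`exists_cube_eq_of_skew`). So `J = ω⁻¹ • X` satisfies `J (J u) = -u` for every `u` in its range.

The curve `cos θ • u + sin θ • J u` solves `c' = J c`, and the norm is constant along it
(`IsInfinitesimalIsometry.norm_cos_add_sin`): moving by a small `ε` along the curve agrees up to
`o(ε)` with applying an isometry close to the identity, and these errors still tend to zero when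
summed over the `t / ε` steps needed to cover a fixed length `t`. If `‖u‖ = 1`, the plane of `u`
and `J u` thus meets the unit ball in an ellipse. The determinants are `±1` because linear
isometries preserve the measure of the unit ball.
-/

section
open Filter Topology MeasureTheory

/-! ### Skew operators in dimension three -/

/-- A nonzero skew operator in dimension three is, in an orthonormal basis, the cross product with
a vector of length `ω`. -/
theorem exists_cube_eq_of_skew {E : Type*} [NormedAddCommGroup E] [InnerProductSpace ℝ E]
    (hdim : Module.finrank ℝ E = 3) (T : E →ₗ[ℝ] E) (hT : T ≠ 0)
    (hskew : ∀ x y, inner ℝ (T x) y = -inner ℝ x (T y)) :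
    ∃ ω : ℝ, 0 < ω ∧ ∀ x, T (T (T x)) = -(ω ^ 2) • T x := by
  have : FiniteDimensional ℝ E := Module.finite_of_finrank_eq_succ hdim
  let b := (stdOrthonormalBasis ℝ E).reindex (finCongr hdim)
  let m : Fin 3 → Fin 3 → ℝ := fun i j => inner ℝ (b i) (T (b j))
  have hm : ∀ i j, m i j = - m j i := fun i j => by
    simp only [m]
    rw [real_inner_comm, hskew]
  have h00 : m 0 0 = 0 := by linarith [hm 0 0]
  have h11 : m 1 1 = 0 := by linarith [hm 1 1]
  have h22 : m 2 2 = 0 := by linarith [hm 2 2]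
  have hTb : ∀ j, T (b j) = ∑ i, m i j • b i := fun j => (b.sum_repr' _).symm
  have h0 : T (b 0) = m 1 0 • b 1 + m 2 0 • b 2 := by
    rw [hTb, Fin.sum_univ_three, h00]; simp
  have h1 : T (b 1) = -m 1 0 • b 0 + m 2 1 • b 2 := by
    rw [hTb, Fin.sum_univ_three, h11, hm 0 1]; simp
  have h2 : T (b 2) = -m 2 0 • b 0 + -m 2 1 • b 1 := by
    rw [hTb, Fin.sum_univ_three, h22, hm 0 2, hm 1 2]; simp
  have hpos : 0 < m 1 0 ^ 2 + m 2 0 ^ 2 + m 2 1 ^ 2 := by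
    by_contra hle
    have e1 : m 1 0 = 0 := by nlinarith [sq_nonneg (m 1 0), sq_nonneg (m 2 0), sq_nonneg (m 2 1)]
    have e2 : m 2 0 = 0 := by nlinarith [sq_nonneg (m 1 0), sq_nonneg (m 2 0), sq_nonneg (m 2 1)]
    have e3 : m 2 1 = 0 := by nlinarith [sq_nonneg (m 1 0), sq_nonneg (m 2 0), sq_nonneg (m 2 1)]
    refine hT (b.toBasis.ext fun i => ?_)
    fin_cases i <;> simp [h0, h1, h2, e1, e2, e3]
  refine ⟨√(m 1 0 ^ 2 + m 2 0 ^ 2 + m 2 1 ^ 2), Real.sqrt_pos.2 hpos, fun x => ?_⟩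
  rw [Real.sq_sqrt hpos.le]
  suffices h : T ∘ₗ T ∘ₗ T = -(m 1 0 ^ 2 + m 2 0 ^ 2 + m 2 1 ^ 2) • T from
    congrArg (fun S : E →ₗ[ℝ] E => S x) h
  refine b.toBasis.ext fun i => ?_
  fin_cases i <;> simp [h0, h1, h2] <;> module

/-! ### Tangent vectors to the group of linear isometries -/

variable {V : Type*} [NormedAddCommGroup V] [NormedSpace ℝ V]

/-- `X` is a tangent vector at the identity to the group of linear isometries: the limit
of `(A n - 1) / ε n` for linear isometries `A n` and positive `ε n` tending to `0`. -/
def IsInfinitesimalIsometry {V : Type*} [NormedAddCommGroup V] [NormedSpace ℝ V]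
    (X : V →L[ℝ] V) : Prop :=
  ∃ (A : ℕ → V ≃ₗᵢ[ℝ] V) (ε : ℕ → ℝ), (∀ n, 0 < ε n) ∧ Tendsto ε atTop (𝓝 0) ∧
    Tendsto (fun n => (ε n)⁻¹ • (((A n : V ≃L[ℝ] V) : V →L[ℝ] V) - ContinuousLinearMap.id ℝ V))
      atTop (𝓝 X)

theorem IsInfinitesimalIsometry.smul {X : V →L[ℝ] V} (hX : IsInfinitesimalIsometry X)
    {a : ℝ} (ha : 0 < a) : IsInfinitesimalIsometry (a • X) := by
  obtain ⟨A, ε, hpos, hε, hA⟩ := hX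
  refine ⟨A, fun n => ε n / a, fun n => div_pos (hpos n) ha, ?_, ?_⟩
  · simpa using hε.div_const a
  · refine (hA.const_smul a).congr fun n => ?_
    rw [smul_smul, inv_div, div_eq_mul_inv]

/-- By compactness, an infinite group of linear isometries has a nonzero tangent vector at the
identity. -/
theorem exists_isInfinitesimalIsometry [FiniteDimensional ℝ V] [Infinite (V ≃ₗᵢ[ℝ] V)] :
    ∃ X : V →L[ℝ] V, X ≠ 0 ∧ IsInfinitesimalIsometry X := by
  let ι : (V ≃ₗᵢ[ℝ] V) → (V →L[ℝ] V) := fun A => ((A : V ≃L[ℝ] V) : V →L[ℝ] V)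
  have hι : Function.Injective ι := fun A B h =>
    LinearIsometryEquiv.ext fun x => congrArg (fun S : V →L[ℝ] V => S x) h
  have hball : Set.range ι ⊆ Metric.closedBall 0 1 := by
    rintro _ ⟨A, rfl⟩
    rw [mem_closedBall_zero_iff]
    exact ContinuousLinearMap.opNorm_le_bound _ zero_le_one fun x => by simp [ι]
  have : ProperSpace (V →L[ℝ] V) := FiniteDimensional.proper ℝ _
  obtain ⟨L, -, hL⟩ := (Set.infinite_range_of_injective hι).exists_accPt_of_subset_isCompact
    (isCompact_closedBall 0 1) hball
  have hnear : ∀ r > 0, ∃ A : V ≃ₗᵢ[ℝ] V, ι A - ContinuousLinearMap.id ℝ V ≠ 0 ∧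
      ‖ι A - ContinuousLinearMap.id ℝ V‖ < r := by
    intro r hr
    rw [accPt_iff_frequently] at hL
    obtain ⟨_, ⟨hAL, A, rfl⟩, hA⟩ :=
      (hL.and_eventually (Metric.ball_mem_nhds L (half_pos hr))).exists
    obtain ⟨_, ⟨-, B, rfl⟩, hB⟩ := (hL.and_eventually
      (Metric.ball_mem_nhds L (lt_min (half_pos hr) (dist_pos.2 hAL)))).exists
    have hBr : dist (ι B) L < r / 2 := (Metric.mem_ball.1 hB).trans_le (min_le_left _ _)
    have hBA : dist (ι B) L < dist (ι A) L := (Metric.mem_ball.1 hB).trans_le (min_le_right _ _)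
    -- `A` and `B` differ and both lie within `r / 2` of `L`, so `B⁻¹ A` is as required.
    refine ⟨A.trans B.symm, fun h => ?_, ?_⟩
    · have hAB : A = B := LinearIsometryEquiv.ext fun x => by
        have hx : B.symm (A x) = x :=
          sub_eq_zero.1 (congrArg (fun S : V →L[ℝ] V => S x) h)
        rw [← B.apply_symm_apply (A x), hx]
      exact hBA.ne (by rw [hAB])
    · refine lt_of_le_of_lt ?_
        ((dist_triangle_right (ι A) (ι B) L).trans_lt
          ((add_lt_add (Metric.mem_ball.1 hA) hBr).trans_eq (add_halves r)))
      rw [dist_eq_norm]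
      refine ContinuousLinearMap.opNorm_le_bound _ (norm_nonneg _) fun x => ?_
      have hx : (ι (A.trans B.symm) - ContinuousLinearMap.id ℝ V) x =
          B.symm ((ι A - ι B) x) := by
        simp [ι]
      rw [hx, B.symm.norm_map]
      exact (ι A - ι B).le_opNorm x
  choose A hA0 hA using fun n : ℕ => hnear (1 / ((n : ℝ) + 1)) Nat.one_div_pos_of_nat
  let ε : ℕ → ℝ := fun n => ‖ι (A n) - ContinuousLinearMap.id ℝ V‖
  have hpos : ∀ n, 0 < ε n := fun n => norm_pos_iff.2 (hA0 n)
  have hε : Tendsto ε atTop (𝓝 0) :=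
    squeeze_zero (fun n => (hpos n).le) (fun n => (hA n).le) tendsto_one_div_add_atTop_nhds_zero_nat
  have hsphere : ∀ n, (ε n)⁻¹ • (ι (A n) - ContinuousLinearMap.id ℝ V) ∈
      Metric.sphere (0 : V →L[ℝ] V) 1 := fun n => by
    rw [mem_sphere_zero_iff_norm, norm_smul, norm_inv, norm_norm]
    exact inv_mul_cancel₀ (hpos n).ne'
  obtain ⟨X, hX, φ, hφ, hlim⟩ := (isCompact_sphere (0 : V →L[ℝ] V) 1).tendsto_subseq hsphere
  exact ⟨X, ne_zero_of_mem_unit_sphere ⟨X, hX⟩, fun n => A (φ n), fun n => ε (φ n),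
    fun n => hpos _, hε.comp hφ.tendsto_atTop, hlim⟩

/-- The norm is constant along the orbits of the one-parameter group generated by a tangent vector
`X`, for those vectors `w` on which this group is the rotation `cos θ • w + sin θ • X w`. -/
theorem IsInfinitesimalIsometry.norm_cos_add_sin {X : V →L[ℝ] V}
    (hX : IsInfinitesimalIsometry X) {w : V} (hw : X (X w) = -w) (θ : ℝ) :
    ‖Real.cos θ • w + Real.sin θ • X w‖ = ‖w‖ := by
  obtain ⟨A, ε, hpos, hε, hA⟩ := hX
  set D : ℕ → V →L[ℝ] V :=
    fun n => (ε n)⁻¹ • (((A n : V ≃L[ℝ] V) : V →L[ℝ] V) - ContinuousLinearMap.id ℝ V)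
  let c : ℝ → V := fun t => Real.cos t • w + Real.sin t • X w
  have hAD : ∀ n x, A n x = x + ε n • D n x := fun n x => by
    simp [D, smul_smul, mul_inv_cancel₀ (hpos n).ne']
  have hcX : ∀ t, X (c t) = Real.cos t • X w - Real.sin t • w := fun t => by
    simp [c, hw, sub_eq_add_neg]
  have hadd : ∀ t s, c (t + s) = Real.cos s • c t + Real.sin s • X (c t) := fun t s => by
    rw [hcX]; simp only [c, Real.cos_add, Real.sin_add]; module
  let M : ℝ := ‖w‖ + ‖X w‖
  have hcM : ∀ t, ‖c t‖ ≤ M := fun t => by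
    refine (norm_add_le _ _).trans (add_le_add ?_ ?_) <;> rw [norm_smul]
    · exact mul_le_of_le_one_left (norm_nonneg _) (Real.abs_cos_le_one t)
    · exact mul_le_of_le_one_left (norm_nonneg _) (Real.abs_sin_le_one t)
  have hcXM : ∀ t, ‖X (c t)‖ ≤ M := fun t => by
    rw [hcX]
    refine (norm_sub_le _ _).trans ((add_le_add ?_ ?_).trans_eq (add_comm _ _)) <;> rw [norm_smul]
    · exact mul_le_of_le_one_left (norm_nonneg _) (Real.abs_cos_le_one t)
    · exact mul_le_of_le_one_left (norm_nonneg _) (Real.abs_sin_le_one t)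
  let η : ℕ → ℝ := fun n => (ε n / 2 + ε n ^ 2 / 6 + ‖X - D n‖) * M
  have hη : Tendsto η atTop (𝓝 0) := by
    have h1 : Tendsto (fun n => ‖X - D n‖) atTop (𝓝 0) := by
      simpa using (hA.const_sub X).norm
    simpa using (((hε.div_const 2).add ((hε.pow 2).div_const 6)).add h1).mul_const M
  -- One step along the curve changes the norm by `o(ε n)`, uniformly in `t`: compare
  -- `c (t + ε n)` with `A n (c t)`, which has the norm of `c t`.
  have hstep : ∀ n t, |‖c (t + ε n)‖ - ‖c t‖| ≤ ε n * η n := fun n t => by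
    rw [← (A n).norm_map (c t)]
    refine (abs_norm_sub_norm_le _ _).trans ?_
    have e : c (t + ε n) - A n (c t) = (Real.cos (ε n) - 1) • c t +
        (Real.sin (ε n) - ε n) • X (c t) + ε n • (X - D n) (c t) := by
      rw [hadd, hAD, sub_apply]; module
    have b1 : ‖(Real.cos (ε n) - 1) • c t‖ ≤ ε n ^ 2 / 2 * M := by
      rw [norm_smul, Real.norm_eq_abs]
      refine mul_le_mul ?_ (hcM t) (norm_nonneg _) (by positivity)
      rw [abs_le]
      constructor <;> nlinarith [Real.one_sub_sq_div_two_le_cos (x := ε n), Real.cos_le_one (ε n)]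
    have b2 : ‖(Real.sin (ε n) - ε n) • X (c t)‖ ≤ ε n ^ 3 / 6 * M := by
      rw [norm_smul, Real.norm_eq_abs]
      refine mul_le_mul ?_ (hcXM t) (norm_nonneg _) (by have := hpos n; positivity)
      rw [abs_sub_comm]
      simpa [abs_of_pos (hpos n)] using Real.abs_sub_sin_le (ε n)
    have b3 : ‖ε n • (X - D n) (c t)‖ ≤ ε n * (‖X - D n‖ * M) := by
      rw [norm_smul, Real.norm_of_nonneg (hpos n).le]
      exact mul_le_mul_of_nonneg_left (((X - D n).le_opNorm _).trans
        (mul_le_mul_of_nonneg_left (hcM t) (norm_nonneg _))) (hpos n).le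
    rw [e]
    refine (norm_add₃_le.trans (add_le_add_three b1 b2 b3)).trans_eq ?_
    simp only [η]; ring
  have hiter : ∀ n t (k : ℕ), |‖c (t + k * ε n)‖ - ‖c t‖| ≤ k * ε n * η n := fun n t k => by
    induction k with
    | zero => simp
    | succ k ih =>
      have h := abs_add_le (‖c (t + k * ε n + ε n)‖ - ‖c (t + k * ε n)‖)
        (‖c (t + k * ε n)‖ - ‖c t‖)
      have e : t + ((k + 1 : ℕ) : ℝ) * ε n = t + k * ε n + ε n := by push_cast; ring
      rw [e]
      rw [sub_add_sub_cancel] at h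
      push_cast
      linarith [hstep n (t + k * ε n)]
  have hfwd : ∀ a t, 0 ≤ t → ‖c (a + t)‖ = ‖c a‖ := fun a t ht => by
    -- About `t / ε n` steps lead from `a` to `a + t`, with total error at most `t * η n`.
    let k : ℕ → ℕ := fun n => ⌊t / ε n⌋₊
    have hk : ∀ n, k n * ε n ≤ t := fun n =>
      (le_div_iff₀ (hpos n)).1 (Nat.floor_le (div_nonneg ht (hpos n).le))
    have hk' : ∀ n, t - ε n ≤ k n * ε n := fun n => by
      have := (div_lt_iff₀ (hpos n)).1 (Nat.lt_floor_add_one (t / ε n))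
      simp only [k]; linarith
    have hlim : Tendsto (fun n => k n * ε n) atTop (𝓝 t) :=
      tendsto_of_tendsto_of_tendsto_of_le_of_le (by simpa using hε.const_sub t)
        tendsto_const_nhds hk' hk
    have hc : Continuous c := by fun_prop
    have h1 : Tendsto (fun n => ‖c (a + k n * ε n)‖ - ‖c a‖) atTop (𝓝 (‖c (a + t)‖ - ‖c a‖)) :=
      ((hc.norm.tendsto _).comp (hlim.const_add a)).sub_const _
    have h2 : Tendsto (fun n => ‖c (a + k n * ε n)‖ - ‖c a‖) atTop (𝓝 0) :=
      squeeze_zero_norm (fun n => hiter n a (k n)) (by simpa using hlim.mul hη)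
    exact sub_eq_zero.1 (tendsto_nhds_unique h1 h2)
  have h0 : ‖c 0‖ = ‖w‖ := by simp [c]
  rw [← h0]
  rcases le_total 0 θ with h | h
  · simpa using hfwd 0 θ h
  · simpa using (hfwd θ (-θ) (neg_nonneg.2 h)).symm

/-! ### The invariant inner product on the dual space -/

section Moments

variable [MeasurableSpace V] [BorelSpace V] [FiniteDimensional ℝ V]

theorem LinearIsometryEquiv.abs_det_eq_one (A : V ≃ₗᵢ[ℝ] V) :
    |LinearMap.det (A.toLinearEquiv : V →ₗ[ℝ] V)| = 1 := by
  have h := Measure.addHaar_image_linearMap (Measure.addHaar : Measure V)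
    (A.toLinearEquiv : V →ₗ[ℝ] V) (Metric.closedBall 0 1)
  have himg : ((A.toLinearEquiv : V →ₗ[ℝ] V) : V → V) '' Metric.closedBall 0 1 =
      Metric.closedBall 0 1 := by
    simp
  rw [himg] at h
  have hpos : (Measure.addHaar : Measure V) (Metric.closedBall 0 1) ≠ 0 :=
    (Metric.measure_closedBall_pos _ _ one_pos).ne'
  have hfin : (Measure.addHaar : Measure V) (Metric.closedBall 0 1) ≠ ⊤ :=
    measure_closedBall_lt_top.ne
  have h1 := (ENNReal.eq_div_iff hpos hfin).2 ((mul_comm _ _).trans h.symm)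
  rw [ENNReal.div_self hpos hfin, ENNReal.ofReal_eq_one] at h1
  exact h1

theorem LinearIsometryEquiv.measurePreserving_addHaar (A : V ≃ₗᵢ[ℝ] V) :
    MeasurePreserving A (Measure.addHaar : Measure V) Measure.addHaar := by
  refine ⟨A.continuous.measurable, ?_⟩
  have hdet := A.abs_det_eq_one
  have h := Measure.map_linearMap_addHaar_eq_smul_addHaar (Measure.addHaar : Measure V)
    (f := (A.toLinearEquiv : V →ₗ[ℝ] V)) (fun h0 => by simp [h0] at hdet)
  rw [abs_inv, hdet] at h
  simpa using h

theorem Module.Dual.integrableOn_mul (f g : Module.Dual ℝ V) :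
    IntegrableOn (fun x => f x * g x) (Metric.closedBall 0 1) Measure.addHaar :=
  ((f.continuous_of_finiteDimensional.mul g.continuous_of_finiteDimensional).continuousOn
    ).integrableOn_compact (isCompact_closedBall 0 1)

variable (V) in
/-- The form of second moments of the closed unit ball, an inner product on the dual space:
`⟪f, g⟫` is the integral of `f x * g x` over the ball. -/
@[reducible] noncomputable def momentCore : InnerProductSpace.Core ℝ (Module.Dual ℝ V) where
  inner f g := ∫ x in Metric.closedBall (0 : V) 1, f x * g x ∂Measure.addHaar
  conj_inner_symm f g := by simp [mul_comm]
  re_inner_nonneg f := integral_nonneg fun x => mul_self_nonneg (f x)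
  add_left f g h := by
    rw [← integral_add (f.integrableOn_mul h) (g.integrableOn_mul h)]
    simp [add_mul]
  smul_left f g r := by
    rw [conj_trivial, ← integral_const_mul]
    simp [mul_assoc]
  definite f hf := by
    by_contra hne
    have h := (setIntegral_pos_iff_support_of_nonneg_ae
      (Eventually.of_forall fun x => mul_self_nonneg (f x)) (f.integrableOn_mul f)).2 ?_
    · exact h.ne' hf
    obtain ⟨x, hx⟩ : ∃ x, f x ≠ 0 := by
      by_contra! h0
      exact hne (LinearMap.ext h0)
    have hopen : IsOpen ({y | f y ≠ 0} ∩ Metric.ball (0 : V) 1) :=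
      (isOpen_ne_fun f.continuous_of_finiteDimensional continuous_const).inter Metric.isOpen_ball
    have hmem : (‖x‖ + 1)⁻¹ • x ∈ {y | f y ≠ 0} ∩ Metric.ball (0 : V) 1 := by
      have hx1 : 0 < ‖x‖ + 1 := by positivity
      refine ⟨?_, ?_⟩
      · simp [hx, hx1.ne']
      · rw [mem_ball_zero_iff, norm_smul, norm_inv, Real.norm_of_nonneg hx1.le,
          inv_mul_lt_iff₀ hx1]
        linarith
    -- The integrand is nonzero on a nonempty open subset of the ball.
    refine (hopen.measure_pos Measure.addHaar ⟨_, hmem⟩).trans_le (measure_mono ?_)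
    rintro y ⟨hy, hy1⟩
    exact ⟨mul_self_ne_zero.2 hy, Metric.ball_subset_closedBall hy1⟩

theorem momentCore_inner_comp (A : V ≃ₗᵢ[ℝ] V) (f g : Module.Dual ℝ V) :
    (momentCore V).inner (f ∘ₗ (A.toLinearEquiv : V →ₗ[ℝ] V))
      (g ∘ₗ (A.toLinearEquiv : V →ₗ[ℝ] V)) = (momentCore V).inner f g := by
  have h := A.measurePreserving_addHaar.setIntegral_preimage_emb
    A.toHomeomorph.measurableEmbedding (fun x => f x * g x) (Metric.closedBall 0 1)
  have hpre : A ⁻¹' Metric.closedBall 0 1 = Metric.closedBall 0 1 := by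
    simp
  rw [hpre] at h
  exact h

end Moments

/-- The transpose of a tangent vector is skew for the form of second moments, so a tangent vector
acts as a multiple of a rotation by a right angle on its range. -/
theorem IsInfinitesimalIsometry.exists_cube_eq {X : V →L[ℝ] V}
    (hX : IsInfinitesimalIsometry X) (hdim : Module.finrank ℝ V = 3) (hX0 : X ≠ 0) :
    ∃ ω : ℝ, 0 < ω ∧ ∀ x, X (X (X x)) = -(ω ^ 2) • X x := by
  have : FiniteDimensional ℝ V := Module.finite_of_finrank_eq_succ hdim
  obtain ⟨A, ε, hpos, hε, hA⟩ := hX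
  borelize V
  let : NormedAddCommGroup (Module.Dual ℝ V) := (momentCore V).toNormedAddCommGroup
  let : InnerProductSpace ℝ (Module.Dual ℝ V) := InnerProductSpace.ofCore (momentCore V).toCore
  let T : Module.Dual ℝ V →ₗ[ℝ] Module.Dual ℝ V := Module.Dual.transpose (X : V →ₗ[ℝ] V)
  have hself : ∀ f, inner ℝ (T f) f = 0 := fun f => by
    let Φ : (V →L[ℝ] V) →ₗ[ℝ] Module.Dual ℝ V :=
      { toFun := fun B => f ∘ₗ (B : V →ₗ[ℝ] V)
        map_add' := fun B B' => by ext x; simp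
        map_smul' := fun r B => by ext x; simp }
    have hΦ : Continuous Φ := Φ.continuous_of_finiteDimensional
    let a : ℕ → V →L[ℝ] V := fun n => ((A n : V ≃L[ℝ] V) : V →L[ℝ] V)
    have ha : Tendsto a atTop (𝓝 (ContinuousLinearMap.id ℝ V)) := by
      have h : Tendsto (fun n => ContinuousLinearMap.id ℝ V +
          ε n • ((ε n)⁻¹ • (a n - ContinuousLinearMap.id ℝ V))) atTop
          (𝓝 (ContinuousLinearMap.id ℝ V + (0 : ℝ) • X)) := (hε.smul hA).const_add _
      rw [zero_smul, add_zero] at h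
      refine h.congr fun n => ?_
      rw [smul_inv_smul₀ (hpos n).ne', add_sub_cancel]
    -- The form takes equal values at `f ∘ A n` and `f`, so their difference is orthogonal to their
    -- sum; in the limit, `f ∘ X` is orthogonal to `2 f`.
    have hzero : ∀ n, inner ℝ (Φ ((ε n)⁻¹ • (a n - ContinuousLinearMap.id ℝ V)))
        (Φ (a n) + f) = 0 := fun n => by
      have hinv : inner ℝ (Φ (a n)) (Φ (a n)) = inner ℝ f f := momentCore_inner_comp (A n) f f
      have hid : Φ (ContinuousLinearMap.id ℝ V) = f := rfl
      rw [map_smul, map_sub, hid, real_inner_smul_left, inner_sub_left, inner_add_right,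
        inner_add_right, hinv, real_inner_comm (Φ (a n)) f]
      ring
    have hlim := Filter.Tendsto.inner (𝕜 := ℝ) ((hΦ.tendsto X).comp hA)
      (((hΦ.tendsto _).comp ha).add_const f)
    have h0 := tendsto_nhds_unique hlim ((tendsto_const_nhds (x := (0 : ℝ))).congr
      fun n => (hzero n).symm)
    have hid : Φ (ContinuousLinearMap.id ℝ V) = f := rfl
    have hT : Φ X = T f := rfl
    rw [hid, hT, inner_add_right] at h0
    linarith
  have hskew : ∀ f g, inner ℝ (T f) g = -inner ℝ f (T g) := fun f g => by
    have h := hself (f + g)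
    rw [map_add, inner_add_left, inner_add_right, inner_add_right, hself f, hself g,
      real_inner_comm f (T g)] at h
    linarith
  have hsep : ∀ x y : V, (∀ f : Module.Dual ℝ V, f x = f y) → x = y := fun x y h =>
    (Module.forall_dual_apply_eq_zero_iff ℝ (x - y)).1 (fun f => by simp [h f]) |> sub_eq_zero.1
  have hT0 : T ≠ 0 := fun h => hX0 <| ContinuousLinearMap.ext fun x => hsep _ _ fun f => by
    exact (congrArg (fun S : Module.Dual ℝ V →ₗ[ℝ] Module.Dual ℝ V => S f x) h).trans
      (map_zero f).symm
  obtain ⟨ω, hω, hcube⟩ := exists_cube_eq_of_skew (Subspace.dual_finrank_eq.trans hdim) T hT0 hskew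
  refine ⟨ω, hω, fun x => hsep _ _ fun f => ?_⟩
  rw [map_smul]
  exact congrArg (fun φ : Module.Dual ℝ V => φ x) (hcube f)

/-! ### Elliptical sections -/

theorem isEllipse_closedBall_inter {u v : V} (huv : LinearIndependent ℝ ![u, v])
    (h : ∀ θ : ℝ, ‖Real.cos θ • u + Real.sin θ • v‖ = 1) :
    IsEllipse (Metric.closedBall (0 : V) 1 ∩
      ((Submodule.span ℝ {u, v}).toAffineSubspace : Set V)) := by
  have hnorm : ∀ s t : ℝ, ‖s • u + t • v‖ = √(s ^ 2 + t ^ 2) := fun s t => by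
    let z : ℂ := ⟨s, t⟩
    have hs : s = ‖z‖ * Real.cos z.arg := (Complex.norm_mul_cos_arg z).symm
    have ht : t = ‖z‖ * Real.sin z.arg := (Complex.norm_mul_sin_arg z).symm
    have hz : ‖z‖ = √(s ^ 2 + t ^ 2) := by rw [Complex.norm_def, Complex.normSq_apply]; simp [z, sq]
    have e : s • u + t • v = ‖z‖ • (Real.cos z.arg • u + Real.sin z.arg • v) := by
      rw [smul_add, smul_smul, smul_smul, ← hs, ← ht]
    rw [e, norm_smul, h, norm_norm, mul_one, hz]
  refine ⟨0, u, v, huv, ?_⟩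
  ext x
  simp only [Set.mem_inter_iff, mem_closedBall_zero_iff, SetLike.mem_coe,
    Submodule.mem_toAffineSubspace, Submodule.mem_span_pair, Set.mem_ofPred_eq, zero_add]
  constructor
  · rintro ⟨hx, s, t, rfl⟩
    rw [hnorm, Real.sqrt_le_one] at hx
    exact ⟨s, t, hx, rfl⟩
  · rintro ⟨s, t, hst, rfl⟩
    exact ⟨by rwa [hnorm, Real.sqrt_le_one], s, t, rfl⟩

theorem exists_isEllipse_of_infinite (hdim : Module.finrank ℝ V = 3) [Infinite (V ≃ₗᵢ[ℝ] V)] :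
    ∃ P : AffineSubspace ℝ V, Module.finrank ℝ P.direction = 2 ∧
      IsEllipse (Metric.closedBall (0 : V) 1 ∩ (P : Set V)) := by
  have : FiniteDimensional ℝ V := Module.finite_of_finrank_eq_succ hdim
  obtain ⟨X, hX0, hX⟩ := exists_isInfinitesimalIsometry (V := V)
  obtain ⟨ω, hω, hcube⟩ := hX.exists_cube_eq hdim hX0
  obtain ⟨x, hx⟩ : ∃ x, X x ≠ 0 := by
    by_contra! h
    exact hX0 (ContinuousLinearMap.ext h)
  let J : V →L[ℝ] V := ω⁻¹ • X
  have hJ : IsInfinitesimalIsometry J := hX.smul (inv_pos.2 hω)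
  let u : V := ‖X x‖⁻¹ • X x
  have hu : ‖u‖ = 1 := norm_smul_inv_norm (𝕜 := ℝ) hx
  have hJJ : J (J u) = -u := by
    simp only [J, u, FunLike.coe_smul, Pi.smul_apply, map_smul, hcube, smul_smul]
    rw [← neg_smul]
    congr 1
    field_simp
  have hnorm : ∀ θ : ℝ, ‖Real.cos θ • u + Real.sin θ • J u‖ = 1 := fun θ =>
    (hJ.norm_cos_add_sin hJJ θ).trans hu
  have hu0 : u ≠ 0 := norm_ne_zero_iff.1 (by rw [hu]; exact one_ne_zero)
  have hli : LinearIndependent ℝ ![u, J u] := by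
    refine LinearIndependent.pair_iff.2 fun s t hst => ?_
    have h2 : s • J u - t • u = 0 := by
      have := congrArg J hst
      rwa [map_add, J.map_smul s u, J.map_smul t (J u), hJJ, map_zero, smul_neg,
        ← sub_eq_add_neg] at this
    have h3 : (s ^ 2 + t ^ 2) • u = 0 := by
      have : (s ^ 2 + t ^ 2) • u = s • (s • u + t • J u) - t • (s • J u - t • u) := by module
      rw [this, hst, h2, smul_zero, smul_zero, sub_zero]
    have h4 := (smul_eq_zero.1 h3).resolve_right hu0
    constructor <;> nlinarith [sq_nonneg s, sq_nonneg t]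
  refine ⟨(Submodule.span ℝ {u, J u}).toAffineSubspace, ?_, isEllipse_closedBall_inter hli hnorm⟩
  have h := finrank_span_eq_card hli
  rw [Matrix.range_cons_cons_empty, Fintype.card_fin] at h
  rwa [Submodule.toAffineSubspace_direction]

theorem finite_linearIsometryEquiv (hdim : Module.finrank ℝ V = 3)
    (hC : ∀ P : AffineSubspace ℝ V, Module.finrank ℝ P.direction = 2 →
      ¬ IsEllipse (Metric.closedBall (0 : V) 1 ∩ (P : Set V))) :
    Finite (V ≃ₗᵢ[ℝ] V) := by
  by_contra h
  rw [not_finite_iff_infinite] at h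
  obtain ⟨P, hP, hE⟩ := exists_isEllipse_of_infinite (V := V) hdim
  exact hC P hP hE

/-! ### The semidirect product decomposition -/

variable (V) in
/-- The linear automorphisms of `V` that preserve the norm. -/
def linearIsometrySubgroup : Subgroup (V ≃ₗ[ℝ] V) where
  carrier := {A | ∀ x, ‖A x‖ = ‖x‖}
  one_mem' _ := rfl
  mul_mem' {A B} hA hB x := (hA (B x)).trans (hB x)
  inv_mem' {A} hA x := by
    have h := hA (A.symm x)
    rw [A.apply_symm_apply] at h
    exact h.symm

/-- An element of `linearIsometrySubgroup V` as a bundled linear isometry. -/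
def linearIsometrySubgroup.toLinearIsometryEquiv (A : linearIsometrySubgroup V) : V ≃ₗᵢ[ℝ] V :=
  ⟨A, A.2⟩

theorem linearIsometrySubgroup.toLinearIsometryEquiv_injective :
    Function.Injective (toLinearIsometryEquiv (V := V)) := fun _ _ h =>
  Subtype.ext (congrArg LinearIsometryEquiv.toLinearEquiv h)

variable (V) in
/-- The homomorphism that sends `(v, A)` to the isometry `x ↦ A x + v`. -/
def semidirectToIsometry :
    Multiplicative V ⋊[translationAction (linearIsometrySubgroup V)] linearIsometrySubgroup V →*
      (V ≃ᵢ V) where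
  toFun p := (linearIsometrySubgroup.toLinearIsometryEquiv p.2).toIsometryEquiv.trans
    (IsometryEquiv.addRight p.1.toAdd)
  map_one' := by
    ext x
    exact add_zero x
  map_mul' p q := by
    ext x
    change p.2.1 (q.2.1 x) + (p.1.toAdd + p.2.1 q.1.toAdd) = p.2.1 (q.2.1 x + q.1.toAdd) + p.1.toAdd
    rw [map_add]
    abel

theorem semidirectToIsometry_apply (p) (x : V) :
    semidirectToIsometry V p x = (p.2 : V ≃ₗ[ℝ] V) x + p.1.toAdd := rfl

/-- Surjectivity is the Mazur–Ulam theorem. -/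
theorem semidirectToIsometry_bijective : Function.Bijective (semidirectToIsometry V) := by
  constructor
  · intro p q h
    have happ : ∀ x, (p.2 : V ≃ₗ[ℝ] V) x + p.1.toAdd = (q.2 : V ≃ₗ[ℝ] V) x + q.1.toAdd :=
      fun x => congrArg (fun f : V ≃ᵢ V => f x) h
    have h0 : p.1.toAdd = q.1.toAdd := by simpa using happ 0
    refine SemidirectProduct.ext h0 (Subtype.ext (LinearEquiv.ext fun x => ?_))
    have hx := happ x
    rw [h0] at hx
    exact add_right_cancel hx
  · intro f
    let g : V ≃ᵢ V := f.trans (IsometryEquiv.addRight (-f 0))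
    let A : V ≃ₗᵢ[ℝ] V := g.toRealLinearIsometryEquivOfMapZero (add_neg_cancel (f 0))
    refine ⟨⟨Multiplicative.ofAdd (f 0), ⟨A.toLinearEquiv, A.norm_map⟩⟩, ?_⟩
    ext x
    exact neg_add_cancel_right (f x) (f 0)

theorem originStabilizer_finite [Finite (V ≃ₗᵢ[ℝ] V)] : Finite (originStabilizer V) :=
  Finite.of_injective
    (fun f : originStabilizer V => (f : V ≃ᵢ V).toRealLinearIsometryEquivOfMapZero f.2)
    fun _ _ h => Subtype.ext <| IsometryEquiv.ext fun x =>
      congrArg (fun A : V ≃ₗᵢ[ℝ] V => A x) h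

end

theorem theorem3 {V : Type*} [NormedAddCommGroup V] [NormedSpace ℝ V]
    (hdim : Module.finrank ℝ V = 3)
    (hC : ∀ P : AffineSubspace ℝ V, Module.finrank ℝ P.direction = 2 →
      ¬ IsEllipse (Metric.closedBall (0 : V) 1 ∩ (P : Set V))) :
    (∃ G : Subgroup (V ≃ₗ[ℝ] V),
      Finite G ∧
      (∀ A ∈ G, LinearMap.det (A : V →ₗ[ℝ] V) = 1 ∨ LinearMap.det (A : V →ₗ[ℝ] V) = -1) ∧
      ∃ e : (Multiplicative V ⋊[translationAction G] G) ≃* (V ≃ᵢ V),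
        ∀ (v : V) (A : G) (x : V),
          e ⟨Multiplicative.ofAdd v, A⟩ x = (A : V ≃ₗ[ℝ] V) x + v) ∧
    Finite (originStabilizer V) := by
  have : FiniteDimensional ℝ V := Module.finite_of_finrank_eq_succ hdim
  have : Finite (V ≃ₗᵢ[ℝ] V) := finite_linearIsometryEquiv hdim hC
  borelize V
  refine ⟨⟨linearIsometrySubgroup V,
    Finite.of_injective _ linearIsometrySubgroup.toLinearIsometryEquiv_injective, fun A hA => ?_,
    MulEquiv.ofBijective (semidirectToIsometry V) semidirectToIsometry_bijective,
    fun v A x => semidirectToIsometry_apply _ x⟩, originStabilizer_finite⟩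
  exact eq_or_eq_neg_of_abs_eq (LinearIsometryEquiv.abs_det_eq_one ⟨A, hA⟩)
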